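/- For a bounded real sequence $x=(x(n))_{n\in\omega}\in\ell_\infty$, let $\mathrm{L}_x$ be the set of its accumulation points, i.e. of those $\eta\in\mathbb{R}$ such that $\{n\in\omega : |x(n)-\eta|<\varepsilon\}$ is infinite for every $\varepsilon>0$. For a cardinal $\kappa$ let $\mathrm{L}(\kappa)=\{x\in\ell_\infty : |\mathrm{L}_x|=\kappa\}$. A subset $M$ of a vector space is called $\kappa$-lineable if $M\cup\{0\}$ contains a linear subspace of dimension $\kappa$. For a non-empty set $A\subseteq\omega$ with $\min A\ge 2$ put \[ \ell(A)=\sup\Bigl\{m\in\omega : \bigcup_{n\in A}\mathrm{L}(n)\ \text{is } m\text{-lineable}\Bigr\}\in\omega\cup\{\infty\}. \] Let $A\subseteq\omega$ be a non-empty finite set with $\min A\ge 2$, and let $k\in\omega$ satisfy $k>2\max A$. Then $\ell(A\cup\{k\})=\ell(A)$. -/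

import Mathlib

namespace AccLineability

open scoped ENNReal

/-- The set of accumulation points of a bounded real sequence `x`: the reals `η` such that
`{n | |x n - η| < ε}` is infinite for every `ε > 0`. -/
def accPoints (x : lp (fun _ : ℕ => ℝ) ∞) : Set ℝ :=
  {η : ℝ | ∀ ε : ℝ, 0 < ε → {n : ℕ | |x n - η| < ε}.Infinite}

/-- `L κ` is the set of all bounded real sequences with exactly `κ` accumulation points. -/
def L (κ : Cardinal.{0}) : Set (lp (fun _ : ℕ => ℝ) ∞) :=
  {x | Cardinal.mk (accPoints x) = κ}

/-- A subset `M` of a real vector space is `κ`-lineable if `M ∪ {0}` contains a linear subspace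
of (algebraic) dimension `κ`. -/
def IsLineable {X : Type*} [AddCommGroup X] [Module ℝ X] (κ : Cardinal) (M : Set X) : Prop :=
  ∃ V : Submodule ℝ X, Module.rank ℝ V = κ ∧ (V : Set X) ⊆ M ∪ {0}

/-- `ell A` is the supremum (possibly `∞`) of the `m : ℕ` such that `⋃ n ∈ A, L n` is
`m`-lineable. -/
noncomputable def ell (A : Set ℕ) : ℕ∞ :=
  sSup {e : ℕ∞ | ∃ m : ℕ, e = (m : ℕ∞) ∧ IsLineable (m : Cardinal) (⋃ n ∈ A, L (n : Cardinal))}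

end AccLineability

/-! Let `V` witness lineability for `A ∪ {k}`. If `V` avoids `L k`, it witnesses lineability for
`A`. Otherwise some `x ∈ V` has `k` accumulation points, and `V` turns out to be a line, a dimension
already attained for `A`. Indeed, let `y ∈ V` be independent of `x`, and let `K` be the finite
planar set of joint cluster points of `(x, y)`. The accumulation points of `a • x + b • y` are the
values of `(a, b)` on `K`. An injective functional gives `|K| = k`. By
`exists_functional_card_lt_two_mul`, another takes strictly between `k / 2` and `k` values, hence
more than `max A`: a contradiction. -/

namespace AccLineability

open Filter Topology
open scoped ENNReal

/-! ### Linear functionals on finite planar sets. -/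

/-- If `(f, g)` is injective on `K` and its image is a chain for the product order, then
`|K| + 1 ≤ |f(K)| + |g(K)|`. -/
theorem card_add_one_le_of_chain {ι : Type*} (K : Finset ι) (hK : K.Nonempty) (f g : ι → ℝ)
    (hinj : ∀ p ∈ K, ∀ q ∈ K, f p = f q → g p = g q → p = q)
    (hchain : ∀ p ∈ K, ∀ q ∈ K, f p < f q → g p ≤ g q) :
    K.card + 1 ≤ (K.image f).card + (K.image g).card := by
  classical
  -- The sum of the `f`-rank and the `g`-rank strictly increases along the chain; ranks start at
  -- `0`, so it takes at most `|f(K)| + |g(K)| - 1` values.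
  let rk : (ι → ℝ) → ι → ℕ := fun h p => ((K.image h).filter (· < h p)).card
  have hlt : ∀ h : ι → ℝ, ∀ p ∈ K, rk h p < (K.image h).card := fun h p hp =>
    Finset.card_lt_card (Finset.filter_ssubset.2 ⟨h p, Finset.mem_image_of_mem h hp, lt_irrefl _⟩)
  have hmono : ∀ h : ι → ℝ, ∀ p q : ι, h p ≤ h q → rk h p ≤ rk h q := fun h p q hpq =>
    Finset.card_le_card (Finset.monotone_filter_right _ fun _ _ ha => lt_of_lt_of_le ha hpq)
  have hstrict : ∀ h : ι → ℝ, ∀ p ∈ K, ∀ q : ι, h p < h q → rk h p < rk h q := by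
    intro h p hp q hpq
    refine Finset.card_lt_card ((Finset.ssubset_iff_of_subset
      (Finset.monotone_filter_right _ fun _ _ ha => lt_trans ha hpq)).2 ⟨h p, ?_, ?_⟩)
    · exact Finset.mem_filter.2 ⟨Finset.mem_image_of_mem h hp, hpq⟩
    · simp
  have hne : ∀ p ∈ K, ∀ q ∈ K, f p < f q → rk f p + rk g p ≠ rk f q + rk g q := by
    intro p hp q hq h
    have h1 := hstrict f p hp q h
    have h2 := hmono g p q (hchain p hp q hq h)
    omega
  have hrk : Set.InjOn (fun p => rk f p + rk g p) K := by
    intro p hp q hq h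
    rcases lt_trichotomy (f p) (f q) with hf | hf | hf
    · exact absurd h (hne p hp q hq hf)
    · have h1 := (hmono f p q hf.le).antisymm (hmono f q p hf.ge)
      rcases lt_trichotomy (g p) (g q) with hg | hg | hg
      · have h2 := hstrict g p hp q hg
        simp only at h
        omega
      · exact hinj p hp q hq hf hg
      · have h2 := hstrict g q hq p hg
        simp only at h
        omega
    · exact absurd h.symm (hne q hq p hp hf)
  have hcard : K.card ≤ (Finset.range ((K.image f).card + (K.image g).card - 1)).card := by
    refine Finset.card_le_card_of_injOn _ (fun p hp => ?_) hrk
    have h1 := hlt f p hp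
    have h2 := hlt g p hp
    simp only [Finset.coe_range, Set.mem_Iio]
    omega
  obtain ⟨p, hp⟩ := hK
  have h1 := hlt f p hp
  rw [Finset.card_range] at hcard
  omega

/-- A finite planar set with at least two points, on which no nonzero linear functional is
constant, has a non-injective nonzero linear functional with more than half as many values as the
set has points. -/
theorem exists_functional_card_lt_two_mul (K : Finset (ℝ × ℝ)) (hK : 1 < K.card)
    (hconst : ∀ a b : ℝ, (a, b) ≠ 0 → 2 ≤ (K.image fun p => a * p.1 + b * p.2).card) :
    ∃ a b : ℝ, (a, b) ≠ 0 ∧ (K.image fun p => a * p.1 + b * p.2).card < K.card ∧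
      K.card < 2 * (K.image fun p => a * p.1 + b * p.2).card := by
  classical
  obtain ⟨p, hp, q, hq, hpq⟩ := Finset.one_lt_card.1 hK
  obtain ⟨c, hc⟩ : ∃ c, c = p.1 - q.1 := ⟨_, rfl⟩
  obtain ⟨d, hd⟩ : ∃ d, d = p.2 - q.2 := ⟨_, rfl⟩
  have hcd : 0 < c ^ 2 + d ^ 2 := by
    have : c ≠ 0 ∨ d ≠ 0 := by
      by_contra! h
      exact hpq (Prod.ext (by linarith [h.1]) (by linarith [h.2]))
    rcases this with h | h <;> positivity
  -- Orthogonal coordinates along and across `p - q`; `y` identifies `p` and `q`.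
  let x : ℝ × ℝ → ℝ := fun r => c * r.1 + d * r.2
  let y : ℝ × ℝ → ℝ := fun r => -d * r.1 + c * r.2
  have hxy : ∀ r s, x r = x s → y r = y s → r = s := by
    intro r s h1 h2
    simp only [x, y] at h1 h2
    refine Prod.ext (mul_left_cancel₀ hcd.ne' ?_) (mul_left_cancel₀ hcd.ne' ?_)
    · linear_combination c * h1 - d * h2
    · linear_combination d * h1 + c * h2
  have hy0 : (-d, c) ≠ (0 : ℝ × ℝ) := by
    intro h
    rw [Prod.ext_iff] at h
    simp only [Prod.fst_zero, Prod.snd_zero, neg_eq_zero] at h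
    simp [h.1, h.2] at hcd
  have hlt : ∀ h : ℝ × ℝ → ℝ, ∀ r ∈ K, ∀ s ∈ K, r ≠ s → h r = h s →
      (K.image h).card < K.card := fun h r hr s hs hrs he =>
    lt_of_le_of_ne Finset.card_image_le fun hc => hrs (Finset.card_image_iff.1 hc hr hs he)
  have hylt : (K.image y).card < K.card := by
    refine hlt y p hp q hq hpq ?_
    simp only [y]
    linear_combination -d * hc.symm + c * hd.symm
  -- The `t` for which `x + t * y` identifies two points of `K` that `y` separates. At the largest
  -- such `t`, no pair can have `u` increasing and `y` decreasing, so `K` is a chain for `(u, y)`.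
  let T : Finset ℝ := ((K ×ˢ K).filter fun r => y r.1 ≠ y r.2).image
    fun r => -(x r.1 - x r.2) / (y r.1 - y r.2)
  have hT : T.Nonempty := by
    obtain ⟨_, ha, _, hb, hab⟩ := Finset.one_lt_card.1 (hconst (-d) c hy0)
    obtain ⟨r, hr, rfl⟩ := Finset.mem_image.1 ha
    obtain ⟨s, hs, rfl⟩ := Finset.mem_image.1 hb
    exact ⟨_, Finset.mem_image_of_mem _ (Finset.mem_filter.2
      ⟨Finset.mem_product.2 ⟨hr, hs⟩, hab⟩ : (r, s) ∈ _)⟩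
  obtain ⟨t, htT, hmax⟩ := T.exists_max_image id hT
  let u : ℝ × ℝ → ℝ := fun r => (c - t * d) * r.1 + (d + t * c) * r.2
  have hu : ∀ r, u r = x r + t * y r := fun r => by simp only [u, x, y]; ring
  have hu0 : (c - t * d, d + t * c) ≠ (0 : ℝ × ℝ) := by
    intro h
    rw [Prod.ext_iff] at h
    simp only [Prod.fst_zero, Prod.snd_zero] at h
    refine hcd.ne' ?_
    linear_combination c * h.1 + d * h.2
  have hult : (K.image u).card < K.card := by
    obtain ⟨⟨r, s⟩, hrs, rfl⟩ := Finset.mem_image.1 htT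
    obtain ⟨hrs, hne⟩ := Finset.mem_filter.1 hrs
    obtain ⟨hr, hs⟩ := Finset.mem_product.1 hrs
    refine hlt u r hr s hs (fun h => hne (congrArg y h)) ?_
    rw [hu, hu]
    have : y r - y s ≠ 0 := sub_ne_zero.2 hne
    field_simp
    ring
  have key := card_add_one_le_of_chain K ⟨p, hp⟩ u y
    (fun r _ s _ h1 h2 => hxy r s (by rw [hu, hu, h2] at h1; linarith) h2) (by
      intro r hr s hs hlt
      by_contra! hgt
      have hmem : -(x r - x s) / (y r - y s) ∈ T :=
        Finset.mem_image_of_mem (fun r : (ℝ × ℝ) × (ℝ × ℝ) => -(x r.1 - x r.2) / (y r.1 - y r.2))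
          (Finset.mem_filter.2 ⟨Finset.mem_product.2 ⟨hr, hs⟩, hgt.ne'⟩ : (r, s) ∈ _)
      have hle := hmax _ hmem
      simp only [id] at hle
      rw [div_le_iff₀ (by linarith)] at hle
      rw [hu, hu] at hlt
      linarith)
  by_cases h : K.card < 2 * (K.image u).card
  · exact ⟨_, _, hu0, hult, h⟩
  · exact ⟨_, _, hy0, hylt, show _ < 2 * (K.image y).card by omega⟩

/-- Some nonzero linear functional is injective on a given finite planar set; it can be chosen with
first coefficient `1`. -/
theorem exists_injOn_functional (K : Finset (ℝ × ℝ)) :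
    ∃ t : ℝ, (K.image fun p => 1 * p.1 + t * p.2).card = K.card := by
  classical
  obtain ⟨t, ht⟩ := Infinite.exists_notMem_finset
    ((K ×ˢ K).image fun r => -(r.1.1 - r.2.1) / (r.1.2 - r.2.2))
  refine ⟨t, Finset.card_image_of_injOn fun r hr s hs h => ?_⟩
  by_cases h2 : r.2 = s.2
  · exact Prod.ext (by rw [h2] at h; linarith) h2
  · refine absurd (Finset.mem_image.2 ⟨(r, s), Finset.mem_product.2 ⟨hr, hs⟩, ?_⟩) ht
    have : r.2 - s.2 ≠ 0 := sub_ne_zero.2 h2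
    simp only
    rw [div_eq_iff this]
    linarith

/-! ### Joint cluster points and accumulation points of combinations. -/

theorem mem_accPoints_iff_mapClusterPt (x : lp (fun _ : ℕ => ℝ) ∞) (η : ℝ) :
    η ∈ accPoints x ↔ MapClusterPt η atTop x := by
  rw [Metric.nhds_basis_ball.mapClusterPt_iff_frequently]
  simp only [accPoints, Set.mem_ofPred_eq, Nat.frequently_atTop_iff_infinite, Metric.mem_ball,
    Real.dist_eq]

/-- The joint cluster points of two bounded sequences. -/
def jointAccPoints (x y : lp (fun _ : ℕ => ℝ) ∞) : Set (ℝ × ℝ) :=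
  {p | MapClusterPt p atTop fun n => (x n, y n)}

theorem accPoints_linear_combination (x y : lp (fun _ : ℕ => ℝ) ∞) (a b : ℝ) :
    accPoints (a • x + b • y) = (fun p : ℝ × ℝ => a * p.1 + b * p.2) '' jointAccPoints x y := by
  have hcoe : (⇑(a • x + b • y) : ℕ → ℝ)
      = (fun p : ℝ × ℝ => a * p.1 + b * p.2) ∘ fun n => (x n, y n) := by
    ext n
    change a • x n + b • y n = _
    simp
  have hcont : Continuous fun p : ℝ × ℝ => a * p.1 + b * p.2 := by fun_prop
  ext η
  rw [mem_accPoints_iff_mapClusterPt, hcoe]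
  constructor
  · intro h
    -- Along `F` the combination tends to `η`; boundedness gives the pair a cluster point along `F`,
    -- which the functional must send to `η`.
    let F : Filter ℕ :=
      atTop ⊓ comap ((fun p : ℝ × ℝ => a * p.1 + b * p.2) ∘ fun n => (x n, y n)) (𝓝 η)
    have hF : F.NeBot := by
      rw [MapClusterPt, ClusterPt, inf_comm] at h
      rwa [← map_neBot_iff
        ((fun p : ℝ × ℝ => a * p.1 + b * p.2) ∘ fun n => (x n, y n)), Filter.push_pull]
    have hK : IsCompact (Metric.closedBall (0 : ℝ) ‖x‖ ×ˢ Metric.closedBall (0 : ℝ) ‖y‖) :=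
      (isCompact_closedBall _ _).prod (isCompact_closedBall _ _)
    obtain ⟨p, -, hp⟩ := hK.exists_mapClusterPt (f := F) (u := fun n => ((x n, y n) : ℝ × ℝ))
      (tendsto_principal.2 <| Eventually.of_forall fun n => by
        simp only [Set.mem_prod, mem_closedBall_zero_iff]
        exact ⟨lp.norm_apply_le_norm ENNReal.top_ne_zero x n,
          lp.norm_apply_le_norm ENNReal.top_ne_zero y n⟩)
    refine ⟨p, hp.mono inf_le_left, ?_⟩
    have h1 := hp.continuousAt_comp hcont.continuousAt
    have h2 : Tendsto ((fun p : ℝ × ℝ => a * p.1 + b * p.2) ∘ fun n => (x n, y n)) F (𝓝 η) :=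
      tendsto_comap.mono_left inf_le_right
    exact eq_of_nhds_neBot (h1.clusterPt.mono h2)
  · rintro ⟨p, hp, rfl⟩
    exact MapClusterPt.continuousAt_comp hcont.continuousAt hp

theorem jointAccPoints_finite {x y : lp (fun _ : ℕ => ℝ) ∞} (hx : (accPoints x).Finite)
    (hy : (accPoints y).Finite) : (jointAccPoints x y).Finite := by
  refine (hx.prod hy).subset fun p hp => ⟨?_, ?_⟩
  · have := accPoints_linear_combination x y 1 0
    rw [one_smul, zero_smul, add_zero] at this
    rw [this]
    exact ⟨p, hp, by ring⟩
  · have := accPoints_linear_combination x y 0 1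
    rw [one_smul, zero_smul, zero_add] at this
    rw [this]
    exact ⟨p, hp, by ring⟩

theorem finite_accPoints_of_mem {x : lp (fun _ : ℕ => ℝ) ∞} {B : Set ℕ}
    (hx : x ∈ ⋃ n ∈ B, L (n : Cardinal)) : (accPoints x).Finite := by
  simp only [Set.mem_iUnion] at hx
  obtain ⟨n, -, hn⟩ := hx
  rw [← Cardinal.lt_aleph0_iff_set_finite, (hn : Cardinal.mk (accPoints x) = n)]
  exact Cardinal.natCast_lt_aleph0

theorem mem_iUnion_L_iff_ncard {x : lp (fun _ : ℕ => ℝ) ∞} (hx : (accPoints x).Finite)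
    (B : Set ℕ) : x ∈ ⋃ n ∈ B, L (n : Cardinal) ↔ (accPoints x).ncard ∈ B := by
  simp only [Set.mem_iUnion, L, Set.mem_ofPred_eq]
  rw [← Set.cast_ncard hx]
  simp only [Nat.cast_inj, exists_prop]
  exact ⟨fun ⟨n, hn, h⟩ => h ▸ hn, fun h => ⟨_, h, rfl⟩⟩

/-- The pencil spanned by two independent sequences, one of which has `k` accumulation points,
cannot stay in `⋃ n ∈ B ∪ {k}, L n` when `B` lies in `[2, M]` and `2 * M < k`. -/
theorem not_pencil_subset {B : Set ℕ} {M k : ℕ} (hB : ∀ n ∈ B, 2 ≤ n ∧ n ≤ M) (hM : 1 ≤ M)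
    (hk : 2 * M < k) (x y : lp (fun _ : ℕ => ℝ) ∞) (hx : (accPoints x).ncard = k)
    (h : ∀ a b : ℝ, (a, b) ≠ 0 → a • x + b • y ∈ ⋃ n ∈ B ∪ {k}, L (n : Cardinal)) : False := by
  classical
  have hxf : (accPoints x).Finite :=
    finite_accPoints_of_mem (B := B ∪ {k}) (by simpa using h 1 0 (by simp))
  have hyf : (accPoints y).Finite :=
    finite_accPoints_of_mem (B := B ∪ {k}) (by simpa using h 0 1 (by simp))
  obtain ⟨K, hK⟩ := (jointAccPoints_finite hxf hyf).exists_finset_coe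
  have hcard : ∀ a b : ℝ, (accPoints (a • x + b • y)).ncard
      = (K.image fun p => a * p.1 + b * p.2).card := by
    intro a b
    rw [accPoints_linear_combination, ← hK, ← Finset.coe_image, Set.ncard_coe_finset]
  have hmem : ∀ a b : ℝ, (a, b) ≠ 0 →
      (K.image fun p => a * p.1 + b * p.2).card ∈ B ∪ {k} := by
    intro a b hab
    rw [← hcard]
    exact (mem_iUnion_L_iff_ncard (finite_accPoints_of_mem (h a b hab)) _).1 (h a b hab)
  have hle : k ≤ K.card := by
    have := hcard 1 0
    rw [one_smul, zero_smul, add_zero, hx] at this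
    rw [this]
    exact Finset.card_image_le
  -- An injective functional makes `|K|` itself an admissible count, and `|K| ≥ k > M` leaves only
  -- `k`.
  have hKk : K.card = k := by
    obtain ⟨t, ht⟩ := exists_injOn_functional K
    have := hmem 1 t (by simp)
    rw [ht] at this
    rcases this with h' | h'
    · have := (hB _ h').2
      omega
    · exact h'
  obtain ⟨a, b, hab, h1, h2⟩ := exists_functional_card_lt_two_mul K (by omega) (by
    intro a b hab
    rcases hmem a b hab with h' | h'
    · exact (hB _ h').1
    · rw [Set.mem_singleton_iff.1 h']
      omega)
  rcases hmem a b hab with h' | h'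
  · have := (hB _ h').2
    omega
  · rw [Set.mem_singleton_iff] at h'
    omega

/-! ### Dimension one is attained, and not exceeded once `k` occurs. -/

/-- The periodic sequence `i ↦ i % (n + 1)`. -/
noncomputable def modSeq (n : ℕ) : lp (fun _ : ℕ => ℝ) ∞ :=
  ⟨fun i => ((i % (n + 1) : ℕ) : ℝ), memℓp_infty ⟨((n + 1 : ℕ) : ℝ), by
    rintro _ ⟨i, rfl⟩
    simp only [Real.norm_natCast, Nat.cast_le]
    exact (Nat.mod_lt i n.succ_pos).le⟩⟩

theorem accPoints_modSeq (n : ℕ) :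
    accPoints (modSeq n) = ((Finset.range (n + 1)).image (Nat.cast : ℕ → ℝ) : Set ℝ) := by
  ext η
  constructor
  · intro h
    rw [mem_accPoints_iff_mapClusterPt] at h
    refine isClosed_iff_clusterPt.1 (Finset.finite_toSet _).isClosed η
      (h.clusterPt.mono (tendsto_principal.2 (Eventually.of_forall fun i => ?_)))
    exact Finset.mem_coe.2 (Finset.mem_image_of_mem _
      (Finset.mem_range.2 (Nat.mod_lt i n.succ_pos)))
  · intro h
    obtain ⟨j, hj, rfl⟩ := Finset.mem_image.1 (Finset.mem_coe.1 h)
    intro ε hε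
    rw [← Nat.frequently_atTop_iff_infinite, frequently_atTop]
    intro N
    refine ⟨j + (n + 1) * N, by nlinarith, ?_⟩
    have : (modSeq n) (j + (n + 1) * N) = (j : ℝ) := by
      change (((j + (n + 1) * N) % (n + 1) : ℕ) : ℝ) = j
      rw [Nat.add_mul_mod_self_left, Nat.mod_eq_of_lt (Finset.mem_range.1 hj)]
    rw [this, sub_self, abs_zero]
    exact hε

theorem ncard_accPoints_modSeq (n : ℕ) : (accPoints (modSeq n)).ncard = n + 1 := by
  rw [accPoints_modSeq, Set.ncard_coe_finset, Finset.card_image_of_injective _ Nat.cast_injective,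
    Finset.card_range]

theorem accPoints_smul (c : ℝ) (x : lp (fun _ : ℕ => ℝ) ∞) :
    accPoints (c • x) = (fun η => c * η) '' accPoints x := by
  have h1 := accPoints_linear_combination x x c 0
  have h2 := accPoints_linear_combination x x 1 0
  rw [zero_smul, add_zero] at h1 h2
  rw [one_smul] at h2
  rw [h1, h2, Set.image_image]
  simp

/-- Nonzero scaling preserves the number of accumulation points, so the line through one suitable
sequence suffices. -/
theorem isLineable_one {B : Set ℕ} {n : ℕ} (hn : 2 ≤ n) (hB : n ∈ B) :
    IsLineable ((1 : ℕ) : Cardinal) (⋃ n ∈ B, L (n : Cardinal)) := by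
  obtain ⟨n, rfl⟩ : ∃ m, n = m + 1 := ⟨n - 1, by omega⟩
  have hfin : (accPoints (modSeq n)).Finite := by
    rw [accPoints_modSeq]
    exact Finset.finite_toSet _
  have hne : modSeq n ≠ 0 := by
    intro h
    have h1 : ((1 % (n + 1) : ℕ) : ℝ) = 0 := congrArg (fun x : lp (fun _ : ℕ => ℝ) ∞ => x 1) h
    rw [Nat.mod_eq_of_lt (by omega)] at h1
    simp at h1
  refine ⟨Submodule.span ℝ {modSeq n}, ?_, ?_⟩
  · rw [← Module.finrank_eq_rank, finrank_span_singleton hne]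
  · intro y hy
    obtain ⟨c, rfl⟩ := Submodule.mem_span_singleton.1 hy
    rcases eq_or_ne c 0 with rfl | hc
    · right
      simp
    · left
      have h := accPoints_smul c (modSeq n)
      rw [mem_iUnion_L_iff_ncard (h ▸ hfin.image _), h,
        Set.ncard_image_of_injective _ (mul_right_injective₀ hc), ncard_accPoints_modSeq]
      exact hB

theorem rank_le_one_of_mem {B : Set ℕ} {M k : ℕ} (hB : ∀ n ∈ B, 2 ≤ n ∧ n ≤ M) (hM : 1 ≤ M)
    (hk : 2 * M < k) {V : Submodule ℝ (lp (fun _ : ℕ => ℝ) ∞)}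
    (hV : (V : Set (lp (fun _ : ℕ => ℝ) ∞)) ⊆ (⋃ n ∈ B ∪ {k}, L (n : Cardinal)) ∪ {0})
    {x : lp (fun _ : ℕ => ℝ) ∞} (hxV : x ∈ V) (hx0 : x ≠ 0) (hx : (accPoints x).ncard = k) :
    Module.rank ℝ V ≤ 1 := by
  have hspan : V ≤ Submodule.span ℝ {x} := by
    intro y hyV
    by_contra hy
    refine not_pencil_subset hB hM hk x y hx fun a b hab => ?_
    refine (hV (V.add_mem (V.smul_mem a hxV) (V.smul_mem b hyV))).resolve_right fun h => ?_
    rw [Set.mem_singleton_iff] at h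
    rcases eq_or_ne b 0 with rfl | hb
    · rw [zero_smul, add_zero] at h
      exact hab (by simp [(smul_eq_zero.1 h).resolve_right hx0])
    · refine hy (Submodule.mem_span_singleton.2 ⟨-(b⁻¹ * a), ?_⟩)
      have h2 := eq_neg_of_add_eq_zero_right h
      rw [neg_smul, mul_smul, ← smul_neg, ← h2, inv_smul_smul₀ hb]
  exact (Submodule.rank_mono hspan).trans
    ((rank_span_le _).trans (Cardinal.mk_singleton x).le)

end AccLineability

theorem mainTheorem7 (A : Finset ℕ) (hA : A.Nonempty) (hmin : 2 ≤ A.min' hA)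
    (k : ℕ) (hk : 2 * A.max' hA < k) :
    AccLineability.ell ((A : Set ℕ) ∪ {k}) = AccLineability.ell (A : Set ℕ) := by
  have hB : ∀ n ∈ (A : Set ℕ), 2 ≤ n ∧ n ≤ A.max' hA := fun n hn =>
    ⟨hmin.trans (A.min'_le n hn), A.le_max' n hn⟩
  obtain ⟨n, hn⟩ := hA
  apply le_antisymm
  · refine sSup_le ?_
    rintro _ ⟨m, rfl, V, hrank, hV⟩
    by_cases h : (V : Set _) ⊆ (⋃ n ∈ (A : Set ℕ), AccLineability.L (n : Cardinal)) ∪ {0}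
    · exact le_sSup ⟨m, rfl, V, hrank, h⟩
    · obtain ⟨x, hxV, hx⟩ := Set.not_subset.1 h
      have hx0 : x ≠ 0 := fun h0 => hx (Or.inr h0)
      have hxL := (hV hxV).resolve_right hx0
      have hfin := AccLineability.finite_accPoints_of_mem hxL
      have hxk : (AccLineability.accPoints x).ncard = k := by
        rcases (AccLineability.mem_iUnion_L_iff_ncard hfin _).1 hxL with h1 | h1
        · exact absurd (Or.inl ((AccLineability.mem_iUnion_L_iff_ncard hfin _).2 h1)) hx
        · exact h1
      have hle := AccLineability.rank_le_one_of_mem hB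
        ((hB n hn).1.trans (hB n hn).2 |>.trans' one_le_two) hk hV hxV hx0 hxk
      rw [hrank] at hle
      have hm : m ≤ 1 := by exact_mod_cast hle
      -- Here `V` need not lie in the union over `A`; only its dimension bound is compared with the
      -- line from `isLineable_one`.
      exact (Nat.cast_le.2 hm).trans
        (le_sSup ⟨1, rfl, AccLineability.isLineable_one (hB n hn).1 hn⟩)
  · refine sSup_le_sSup ?_
    rintro _ ⟨m, rfl, V, hrank, hV⟩
    exact ⟨m, rfl, V, hrank, hV.trans (Set.union_subset_union_left _
      (Set.biUnion_subset_biUnion_left Set.subset_union_left))⟩
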